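/- Consider a base station serving users $i\in\mathcal N=\{1,\dots,N\}$ over subchannels $k\in\mathcal K=\{1,\dots,K\}$. The parameters are real bandwidths $B_k$, noise variances $\sigma_{k,i}^2>0$, real weights $w_i$, an integer $M\ge 0$, and real power limits $P_{\max}$, $P_{\max,k}$ and minimum average rates $\bar R_{\min,i}$. The channel $\mathbf h=(h_{k,i})$ is a random element of $\mathbb C^{K\times N}$ such that each $h_{k,i}$ is a continuous random variable, that is, $\Pr(h_{k,i}=z)=0$ for all $z\in\mathbb C$, and $\mathbb E[\log(1+|h_{k,i}|^2)]<\infty$. Put $\eta_{k,i}=\sigma_{k,i}^2/|h_{k,i}|^2$ and $$R_i(\mathbf p,\mathbf q;\mathbf h)=\sum_{k\in\mathcal K}B_k\log_2\Bigl(1+\frac{q_{k,i}p_{k,i}}{\sum_{j:\eta_{k,j}<\eta_{k,i}}q_{k,j}p_{k,j}+\eta_{k,i}}\Bigr).$$ Let $\mathcal P=\{\mathbf p\in\mathbb R_{\ge0}^{K\times N}:\sum_{k,i}p_{k,i}\le P_{\max},\ \sum_i p_{k,i}\le P_{\max,k}\ \forall k\}$ and $\mathcal Q=\{\mathbf q\in\{0,1\}^{K\times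 N}:\sum_i q_{k,i}\le M\ \forall k\}$. A policy is a pair of measurable functions $\mathbf h\mapsto\mathbf p^{\mathbf h}\in\mathcal P$, $\mathbf h\mapsto\mathbf q^{\mathbf h}\in\mathcal Q$ of the channel realization. Problem (P2) is to maximize $$\mathbb E_{\mathbf h}\Bigl[\sum_{i} w_iR_i(\mathbf p^{\mathbf h},\mathbf q^{\mathbf h};\mathbf h)\Bigr]\quad\text{over all policies with}\quad \mathbb E_{\mathbf h}\bigl[R_i(\mathbf p^{\mathbf h},\mathbf q^{\mathbf h};\mathbf h)\bigr]\ge\bar R_{\min,i}\ \text{ for all } i\in\mathcal N .$$ Its Lagrange dual (D) is to minimize, over $\boldsymbol\lambda\in\mathbb R_{\ge0}^N$, $$F(\boldsymbol\lambda)=\sup_{\text{policies}}\Bigl\{\mathbb E_{\mathbf h}\Bigl[\sum_i w_iR_i(\mathbf p^{\mathbf h},\mathbf q^{\mathbf h};\mathbf h)\Bigr]+\sum_i\lambda_i\bigl(\mathbb E_{\mathbf h}[R_i(\mathbf p^{\mathbf h},\mathbf q^{\mathbf h};\mathbf h)]-\bar R_{\min,i}\bigr)\Bigr\}.$$ Then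 strong duality holds: the optimal value (supremum) of (P2) equals the optimal value (infimum) of (D), with zero duality gap. Here values are taken in $[-\infty,\infty]$, the supremum over the empty set being $-\infty$; in particular, if (P2) is infeasible, the dual value is $-\infty$. -/

import Mathlib

open MeasureTheory

noncomputable section

namespace MCNOMA

/-- Channel state: the gain `h k i` of the link from the base station to user `i` on
subchannel `k`. -/
abbrev Channel (K N : ℕ) : Type := Fin K → Fin N → ℂ

/-- Deterministic parameters of a downlink multicarrier NOMA system with `K` subchannels and
`N` users. -/
structure System (K N : ℕ) where
  /-- bandwidth of each subchannel -/
  B : Fin K → ℝ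
  /-- noise variance of user `i` on subchannel `k` -/
  noise : Fin K → Fin N → ℝ
  /-- weights of the users -/
  w : Fin N → ℝ
  /-- maximal number of users multiplexed on one subchannel -/
  M : ℕ
  /-- total transmission power budget -/
  Pmax : ℝ
  /-- maximum power on each subchannel -/
  PmaxSub : Fin K → ℝ
  /-- minimum average data rate required by each user -/
  Rmin : Fin N → ℝ

variable {K N : ℕ}

namespace System

/-- Noise-to-channel ratio of user `i` on subchannel `k`. -/
def ncr (S : System K N) (h : Channel K N) (k : Fin K) (i : Fin N) : ℝ :=
  S.noise k i / ‖h k i‖ ^ 2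

/-- Data rate of user `i` on subchannel `k`: after successive interference cancellation only the
signals of users with a strictly smaller noise-to-channel ratio interfere. -/
def subRate (S : System K N) (p q : Fin K → Fin N → ℝ) (h : Channel K N)
    (k : Fin K) (i : Fin N) : ℝ :=
  S.B k * Real.logb 2
    (1 + q k i * p k i /
      ((∑ j : Fin N with S.ncr h k j < S.ncr h k i, q k j * p k j) + S.ncr h k i))

/-- Data rate of user `i` over all subchannels. -/
def rate (S : System K N) (p q : Fin K → Fin N → ℝ) (h : Channel K N) (i : Fin N) : ℝ :=
  ∑ k, S.subRate p q h k i

/-- Feasible power allocations. -/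
def powerSet (S : System K N) : Set (Fin K → Fin N → ℝ) :=
  {p | (∑ i, ∑ k, p k i ≤ S.Pmax) ∧ (∀ k, ∑ i, p k i ≤ S.PmaxSub k) ∧ ∀ k i, 0 ≤ p k i}

/-- Feasible subchannel assignments. -/
def assignSet (S : System K N) : Set (Fin K → Fin N → ℝ) :=
  {q | (∀ k i, q k i = 0 ∨ q k i = 1) ∧ ∀ k, ∑ i, q k i ≤ S.M}

/-- A policy prescribes, as measurable functions of the channel state, a feasible power
allocation and a feasible subchannel assignment. -/
structure Policy (S : System K N) where
  p : Channel K N → Fin K → Fin N → ℝ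
  q : Channel K N → Fin K → Fin N → ℝ
  measurable_p : Measurable p
  measurable_q : Measurable q
  p_mem : ∀ h, p h ∈ S.powerSet
  q_mem : ∀ h, q h ∈ S.assignSet

variable {Ω : Type*} [MeasurableSpace Ω]

/-- Average data rate of user `i` under a policy, for the random channel `h` under `ℙ`. -/
def avgRate (S : System K N) (ℙ : Measure Ω) (h : Ω → Channel K N) (π : S.Policy)
    (i : Fin N) : ℝ :=
  ∫ ω, S.rate (π.p (h ω)) (π.q (h ω)) (h ω) i ∂ℙ

/-- Weighted average sum rate of a policy: the primal objective. -/
def objective (S : System K N) (ℙ : Measure Ω) (h : Ω → Channel K N) (π : S.Policy) : ℝ :=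
  ∫ ω, ∑ i, S.w i * S.rate (π.p (h ω)) (π.q (h ω)) (h ω) i ∂ℙ

/-- Optimal value of the primal problem: maximize the weighted average sum rate over all policies
that meet the minimum average rate constraints (`⊥` if there is none). -/
def primalValue (S : System K N) (ℙ : Measure Ω) (h : Ω → Channel K N) : EReal :=
  ⨆ (π : S.Policy) (_ : ∀ i, S.Rmin i ≤ S.avgRate ℙ h π i), (S.objective ℙ h π : EReal)

/-- The Lagrangian, with multiplier `l i` on the minimum average rate constraint of user `i`. -/
def lagrangian (S : System K N) (ℙ : Measure Ω) (h : Ω → Channel K N) (π : S.Policy)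
    (l : Fin N → ℝ) : ℝ :=
  S.objective ℙ h π + ∑ i, l i * (S.avgRate ℙ h π i - S.Rmin i)

/-- The dual function: the supremum of the Lagrangian over all policies. -/
def dualFunction (S : System K N) (ℙ : Measure Ω) (h : Ω → Channel K N)
    (l : Fin N → ℝ) : EReal :=
  ⨆ π : S.Policy, (S.lagrangian ℙ h π l : EReal)

/-- Optimal value of the dual problem: minimize the dual function over nonnegative
multipliers. -/
def dualValue (S : System K N) (ℙ : Measure Ω) (h : Ω → Channel K N) : EReal :=
  ⨅ (l : Fin N → ℝ) (_ : ∀ i, 0 ≤ l i), S.dualFunction ℙ h l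

end System

end MCNOMA

end

/-! Because the channel law has no atoms, the set of achievable average rate vectors is compact and
convex, although the rates are not concave in the powers and the assignments are binary. Objective
and constraints are linear in the average rate vector, so the problem becomes a linear program over
that set. Separating the graph of the objective from an orthant then gives zero gap, without a
Slater condition (`exists_feasible_of_forall_multiplier`).

Compactness and convexity both follow from `achievable_eq`: the achievable set is the intersection
of the half-spaces whose bounds are the integrals over channel states of the pointwise maximal
weighted rates. That a vector in all these half-spaces is attained is an Aumann-type theorem
(`MeasurableCorrespondence.exists_selection_integral_pairing`), proved by induction on dimension.
The admissible actions are shrunk to a fixed selection on a growing set of states until some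
half-space becomes tight, and the argument continues on the face of maximizers of that functional.
Atomlessness makes the shrinking continuous. Measurability and the support inequalities survive
passage to a face because maximizing over a face is a limit of penalized maximizations
(`tendsto_sSup_penalized`). -/

/-! ### Measurable correspondences and selections -/

section Correspondences

open Filter Topology

variable {H X ι : Type*} [Fintype ι]

/-- Maximizers of `f` over `G`. -/
def maximizers (G : Set X) (f : X → ℝ) : Set X := {x ∈ G | f x = sSup (f '' G)}

/-- The pairing of `ℓ` with a vector-valued integrand. -/
def pairing (ℓ : ι → ℝ) (r : H → X → ι → ℝ) (h : H) (x : X) : ℝ := ∑ i, ℓ i * r h x i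

theorem sSup_image_le_of_forall {G : Set X} (hne : G.Nonempty) {f : X → ℝ} {c : ℝ}
    (hf : ∀ x ∈ G, f x ≤ c) : sSup (f '' G) ≤ c :=
  csSup_le (hne.image f) (by rintro _ ⟨x, hx, rfl⟩; exact hf x hx)

theorem abs_sSup_image_le {G : Set X} (hne : G.Nonempty) {f : X → ℝ} {c : ℝ}
    (hf : ∀ x ∈ G, |f x| ≤ c) : |sSup (f '' G)| ≤ c := by
  obtain ⟨x, hx⟩ := hne
  refine abs_le.2 ⟨?_, sSup_image_le_of_forall ⟨x, hx⟩ fun y hy => (abs_le.1 (hf y hy)).2⟩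
  refine (abs_le.1 (hf x hx)).1.trans (le_csSup ⟨c, ?_⟩ (Set.mem_image_of_mem f hx))
  rintro _ ⟨y, hy, rfl⟩
  exact (abs_le.1 (hf y hy)).2

theorem abs_pairing_le {r : H → X → ι → ℝ} {b : H → ℝ} (hb : ∀ h x i, |r h x i| ≤ b h)
    (ℓ : ι → ℝ) (h : H) (x : X) : |pairing ℓ r h x| ≤ (∑ i, |ℓ i|) * b h := by
  rw [Finset.sum_mul]
  refine (Finset.abs_sum_le_sum_abs _ _).trans (Finset.sum_le_sum fun i _ => ?_)
  rw [abs_mul]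
  exact mul_le_mul_of_nonneg_left (hb h x i) (abs_nonneg _)

theorem pairing_add_smul (r : H → X → ι → ℝ) (ℓ ℓ' : ι → ℝ) (t : ℝ) (h : H) (x : X) :
    pairing (ℓ + t • ℓ') r h x = pairing ℓ r h x + t * pairing ℓ' r h x := by
  simp [pairing, add_mul, Finset.sum_add_distrib, Finset.mul_sum, mul_assoc]

variable [MeasurableSpace H] [TopologicalSpace X]

/-- Integrands that are measurable in the state and continuous in the action. -/
structure Caratheodory (g : H → X → ℝ) : Prop where
  measurable : ∀ x, Measurable fun h => g h x
  continuous : ∀ h, Continuous (g h)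

/-- Set-valued maps with nonempty compact values, along which maximizing a Carathéodory integrand
gives a measurable function. -/
structure MeasurableCorrespondence (G : H → Set X) : Prop where
  nonempty : ∀ h, (G h).Nonempty
  isCompact : ∀ h, IsCompact (G h)
  measurable_sSup : ∀ g : H → X → ℝ, Caratheodory g → Measurable fun h => sSup (g h '' G h)

theorem IsCompact.le_sSup_image {G : Set X} (hG : IsCompact G) {f : X → ℝ} (hf : Continuous f)
    {x : X} (hx : x ∈ G) : f x ≤ sSup (f '' G) :=
  le_csSup (hG.image hf).bddAbove (Set.mem_image_of_mem f hx)

theorem IsCompact.maximizers {G : Set X} (hG : IsCompact G) {f : X → ℝ} (hf : Continuous f) :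
    IsCompact (maximizers G f) :=
  hG.inter_right (isClosed_eq hf continuous_const)

theorem IsCompact.maximizers_nonempty {G : Set X} (hG : IsCompact G) (hne : G.Nonempty)
    {f : X → ℝ} (hf : Continuous f) : (_root_.maximizers G f).Nonempty := by
  obtain ⟨x, hx, hfx⟩ := hG.exists_sSup_image_eq hne hf.continuousOn
  exact ⟨x, hx, hfx.symm⟩

theorem sSup_maximizers_le_penalized {G : Set X} (hG : IsCompact G) (hne : G.Nonempty)
    {f g : X → ℝ} (hf : Continuous f) (hg : Continuous g) (t : ℝ) :
    sSup (f '' maximizers G g) ≤ sSup ((fun x => f x + t * (g x - sSup (g '' G))) '' G) := by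
  refine sSup_image_le_of_forall (hG.maximizers_nonempty hne hg) fun x hx => ?_
  have := hG.le_sSup_image (f := fun x => f x + t * (g x - sSup (g '' G))) (by fun_prop) hx.1
  simpa [hx.2] using this

/-- Maximizing `f` over the maximizers of `g` is the limit of penalized maximizations. -/
theorem tendsto_sSup_penalized {G : Set X} (hG : IsCompact G) (hne : G.Nonempty)
    {f g : X → ℝ} (hf : Continuous f) (hg : Continuous g) :
    Tendsto (fun n : ℕ => sSup ((fun x => f x + n * (g x - sSup (g '' G))) '' G)) atTop
      (𝓝 (sSup (f '' maximizers G g))) := by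
  set m := sSup (g '' G) with hm
  set s := sSup (f '' maximizers G g) with hs
  refine tendsto_order.2 ⟨fun a ha => Eventually.of_forall fun n =>
    ha.trans_le (sSup_maximizers_le_penalized hG hne hf hg n), fun b hb => ?_⟩
  obtain ⟨c, hsc, hcb⟩ := exists_between hb
  have hle : ∀ x ∈ G, g x ≤ m := fun x hx => hG.le_sSup_image hg hx
  have hK : IsCompact (G ∩ {x | c ≤ f x}) := hG.inter_right (isClosed_le continuous_const hf)
  -- Points with `f x < c` need no penalty. On the compact set where `c ≤ f`, no point maximizes
  -- `g`, since `s < c`; so `g` stays below `m` by a fixed gap there, and a large multiple of that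
  -- gap outweighs the maximum of `f`.
  have key : ∃ n₀ : ℕ, ∀ n ≥ n₀, ∀ x ∈ G, f x + n * (g x - m) ≤ c := by
    rcases (G ∩ {x | c ≤ f x}).eq_empty_or_nonempty with h0 | h0
    · refine ⟨0, fun n _ x hx => ?_⟩
      have h1 : f x < c := by
        by_contra! h2
        have : x ∈ G ∩ {x | c ≤ f x} := ⟨hx, h2⟩
        simp [h0] at this
      have h2 : (n : ℝ) * (g x - m) ≤ 0 :=
        mul_nonpos_of_nonneg_of_nonpos n.cast_nonneg (sub_nonpos.2 (hle x hx))
      linarith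
    · obtain ⟨y, hy, hymax⟩ := hK.exists_isMaxOn h0 hg.continuousOn
      obtain ⟨z, hz, hzmax⟩ := hK.exists_isMaxOn h0 hf.continuousOn
      have hgy : g y < m := by
        refine lt_of_le_of_ne (hle y hy.1) fun heq => ?_
        have : f y ≤ s := (hG.maximizers hg).le_sSup_image hf ⟨hy.1, heq⟩
        exact absurd (hy.2 : c ≤ f y) (not_le.2 (this.trans_lt hsc))
      obtain ⟨n₀, hn₀⟩ := exists_nat_ge ((f z - c) / (m - g y))
      rw [div_le_iff₀ (sub_pos.2 hgy)] at hn₀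
      refine ⟨n₀, fun n hn x hx => ?_⟩
      have hn' : (n₀ : ℝ) ≤ n := by exact_mod_cast hn
      rcases lt_or_ge (f x) c with h1 | h1
      · have h2 : (n : ℝ) * (g x - m) ≤ 0 :=
          mul_nonpos_of_nonneg_of_nonpos n.cast_nonneg (sub_nonpos.2 (hle x hx))
        linarith
      · have h2 : g x ≤ g y := hymax ⟨hx, h1⟩
        have h3 : f x ≤ f z := hzmax ⟨hx, h1⟩
        have h4 : (n₀ : ℝ) * (m - g y) ≤ n * (m - g y) :=
          mul_le_mul_of_nonneg_right hn' (sub_pos.2 hgy).le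
        have h5 : (n : ℝ) * (m - g y) ≤ n * (m - g x) :=
          mul_le_mul_of_nonneg_left (by linarith) n.cast_nonneg
        linarith
  obtain ⟨n₀, hn₀⟩ := key
  filter_upwards [eventually_ge_atTop n₀] with n hn
  exact (sSup_image_le_of_forall hne (hn₀ n hn)).trans_lt hcb

theorem MeasurableCorrespondence.univ [CompactSpace X] [TopologicalSpace.SeparableSpace X]
    [Nonempty X] : MeasurableCorrespondence fun _ : H => (Set.univ : Set X) where
  nonempty _ := Set.univ_nonempty
  isCompact _ := isCompact_univ
  measurable_sSup g hg := by
    refine measurable_of_Iic fun c => ?_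
    have : (fun h => sSup (g h '' Set.univ)) ⁻¹' Set.Iic c =
        ⋂ n, {h | g h (TopologicalSpace.denseSeq X n) ≤ c} := by
      ext h
      simp only [Set.mem_preimage, Set.mem_Iic, Set.mem_iInter, Set.mem_ofPred_eq]
      refine ⟨fun hc n => (isCompact_univ.le_sSup_image (hg.continuous h) trivial).trans hc,
        fun hc => sSup_image_le_of_forall Set.univ_nonempty fun x _ => ?_⟩
      have hcl : IsClosed {x | g h x ≤ c} := isClosed_le (hg.continuous h) continuous_const
      have := (TopologicalSpace.denseRange_denseSeq X).closure_eq ▸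
        hcl.closure_subset_iff.2 (Set.range_subset_iff.2 hc)
      exact this (Set.mem_univ x)
    rw [this]
    exact MeasurableSet.iInter fun n => measurableSet_le (hg.measurable _) measurable_const

/-- The penalized integrand is again Carathéodory, as the supremum of `g` is measurable in the
state. Its suprema over `G` are therefore measurable and converge pointwise to the supremum over the
face. -/
theorem MeasurableCorrespondence.maximizers {G : H → Set X} (hG : MeasurableCorrespondence G)
    {g : H → X → ℝ} (hg : Caratheodory g) :
    MeasurableCorrespondence fun h => maximizers (G h) (g h) where
  nonempty h := (hG.isCompact h).maximizers_nonempty (hG.nonempty h) (hg.continuous h)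
  isCompact h := (hG.isCompact h).maximizers (hg.continuous h)
  measurable_sSup f hf := by
    refine measurable_of_tendsto_metrizable (fun n : ℕ => hG.measurable_sSup
      (fun h x => f h x + n * (g h x - sSup (g h '' G h))) ⟨fun x => ?_, fun h => ?_⟩)
      (tendsto_pi_nhds.2 fun h => tendsto_sSup_penalized (hG.isCompact h) (hG.nonempty h)
        (hf.continuous h) (hg.continuous h))
    · exact (hf.measurable x).add
        (((hg.measurable x).sub (hG.measurable_sSup g hg)).const_mul _)
    · have := hf.continuous h
      have := hg.continuous h
      fun_prop

theorem MeasurableCorrespondence.ite {G G' : H → Set X} (hG : MeasurableCorrespondence G)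
    (hG' : MeasurableCorrespondence G') {T : H → ℝ} (hT : Measurable T) (s : ℝ) :
    MeasurableCorrespondence fun h => if T h ≤ s then G h else G' h where
  nonempty h := by split_ifs; exacts [hG.nonempty h, hG'.nonempty h]
  isCompact h := by split_ifs; exacts [hG.isCompact h, hG'.isCompact h]
  measurable_sSup f hf := by
    have : (fun h => sSup (f h '' (if T h ≤ s then G h else G' h))) =
        fun h => if T h ≤ s then sSup (f h '' G h) else sSup (f h '' G' h) := by
      funext h; split_ifs <;> rfl
    rw [this]
    exact Measurable.ite (measurableSet_le hT measurable_const) (hG.measurable_sSup f hf)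
      (hG'.measurable_sSup f hf)

/-- Every measurable correspondence has a measurable selection. -/
theorem MeasurableCorrespondence.exists_selection {κ : Type*} [Fintype κ] {c : κ → X → ℝ}
    (hc : ∀ j, Continuous (c j)) (hinj : ∀ x y, (∀ j, c j x = c j y) → x = y)
    {G : H → Set X} (hG : MeasurableCorrespondence G) :
    ∃ u : H → X, (∀ h, u h ∈ G h) ∧ MeasurableCorrespondence fun h => {u h} := by
  classical
  -- Lexicographic maximization: each round passes to a face on which one more `c j` is constant.
  -- After all rounds, separation of points leaves a single point.
  have key : ∀ s : Finset κ, ∃ G' : H → Set X, MeasurableCorrespondence G' ∧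
      (∀ h, G' h ⊆ G h) ∧ ∀ j ∈ s, ∀ h, ∀ x ∈ G' h, ∀ y ∈ G' h, c j x = c j y := by
    intro s
    induction s using Finset.induction_on with
    | empty => exact ⟨G, hG, fun h => subset_rfl, by simp⟩
    | insert j s hj ih =>
      obtain ⟨G', hG', hsub, hs⟩ := ih
      refine ⟨_, hG'.maximizers (g := fun _ => c j) ⟨fun x => measurable_const, fun _ => hc j⟩,
        fun h x hx => hsub h hx.1, fun i hi h x hx y hy => ?_⟩
      rcases Finset.mem_insert.1 hi with rfl | hi
      · exact hx.2.trans hy.2.symm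
      · exact hs i hi h x hx.1 y hy.1
  obtain ⟨G', hG', hsub, hs⟩ := key Finset.univ
  choose u hu using hG'.nonempty
  refine ⟨u, fun h => hsub h (hu h), ?_⟩
  have : (fun h => {u h}) = G' := funext fun h => (Set.eq_singleton_iff_unique_mem.2
    ⟨hu h, fun x hx => hinj _ _ fun j => hs j (Finset.mem_univ j) h x hx _ (hu h)⟩).symm
  rwa [this]

theorem MeasurableCorrespondence.measurable_comp {u : H → X}
    (hu : MeasurableCorrespondence fun h => {u h}) {g : H → X → ℝ} (hg : Caratheodory g) :
    Measurable fun h => g h (u h) := by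
  simpa using hu.measurable_sSup g hg

theorem caratheodory_pairing {r : H → X → ι → ℝ}
    (hr : ∀ i, Caratheodory fun h x => r h x i) (ℓ : ι → ℝ) : Caratheodory (pairing ℓ r) where
  measurable x := Finset.measurable_sum _ fun i _ => ((hr i).measurable x).const_mul _
  continuous h := continuous_finsetSum _ fun i _ => ((hr i).continuous h).const_mul _

end Correspondences

/-! ### Integrals of selections: an Aumann-type theorem -/

section SelectionIntegrals

open Filter Topology

theorem sSup_image_const_mul {X : Type*} {G : Set X} (f : X → ℝ) {t : ℝ} (ht : 0 ≤ t) :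
    sSup ((fun x => t * f x) '' G) = t * sSup (f '' G) := by
  rw [← smul_eq_mul, ← Real.sSup_smul_of_nonneg ht, ← Set.image_smul, Set.image_image]
  rfl

variable {H X ι : Type*} [MeasurableSpace H] [TopologicalSpace X]
  {μ : Measure H} {r : H → X → ι → ℝ} {b : H → ℝ} {T : H → ℝ}

theorem MeasurableCorrespondence.integrable_comp {u : H → X}
    (hu : MeasurableCorrespondence fun h => {u h}) (hr : ∀ i, Caratheodory fun h x => r h x i)
    (hb : ∀ h x i, |r h x i| ≤ b h) (hbi : Integrable b μ) (i : ι) :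
    Integrable (fun h => r h (u h) i) μ :=
  hbi.mono' (hu.measurable_comp (hr i)).aestronglyMeasurable
    (Eventually.of_forall fun h => hb h (u h) i)

variable [Fintype ι]

theorem MeasurableCorrespondence.integrable_sSup_pairing {G : H → Set X}
    (hG : MeasurableCorrespondence G) (hr : ∀ i, Caratheodory fun h x => r h x i)
    (hb : ∀ h x i, |r h x i| ≤ b h) (hbi : Integrable b μ) (ℓ : ι → ℝ) :
    Integrable (fun h => sSup (pairing ℓ r h '' G h)) μ :=
  (hbi.const_mul (∑ i, |ℓ i|)).mono'
    (hG.measurable_sSup _ (caratheodory_pairing hr ℓ)).aestronglyMeasurable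
    (Eventually.of_forall fun h => abs_sSup_image_le (hG.nonempty h) fun x _ =>
      abs_pairing_le hb ℓ h x)

theorem MeasurableCorrespondence.integral_pairing_comp {u : H → X}
    (hu : MeasurableCorrespondence fun h => {u h}) (hr : ∀ i, Caratheodory fun h x => r h x i)
    (hb : ∀ h x i, |r h x i| ≤ b h) (hbi : Integrable b μ) (ℓ : ι → ℝ) :
    ∫ h, pairing ℓ r h (u h) ∂μ = ∑ i, ℓ i * ∫ h, r h (u h) i ∂μ := by
  simp only [pairing]
  rw [integral_finsetSum _ fun i _ => (hu.integrable_comp hr hb hbi i).const_mul _]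
  simp only [integral_const_mul]

/-- The integrated support function of a correspondence cut off along the level sets of `T` is
jointly continuous in the level and the functional. -/
theorem MeasurableCorrespondence.continuous_integral_sSup_ite {G G' : H → Set X}
    (hG : MeasurableCorrespondence G) (hG' : MeasurableCorrespondence G')
    (hr : ∀ i, Caratheodory fun h x => r h x i) (hb : ∀ h x i, |r h x i| ≤ b h)
    (hbi : Integrable b μ) (hT : Measurable T) (hT0 : ∀ s, μ {h | T h = s} = 0) :
    Continuous fun p : ℝ × (ι → ℝ) =>
      ∫ h, sSup (pairing p.2 r h '' (if T h ≤ p.1 then G h else G' h)) ∂μ := by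
  refine continuous_iff_continuousAt.2 fun p₀ => ?_
  refine continuousAt_of_dominated (bound := fun h => (∑ i, |p₀.2 i| + 1) * |b h|)
    (Eventually.of_forall fun p => ((hG.ite hG' hT p.1).measurable_sSup _
      (caratheodory_pairing hr p.2)).aestronglyMeasurable) ?_ (hbi.abs.const_mul _) ?_
  · have hc : Continuous fun p : ℝ × (ι → ℝ) => ∑ i, |p.2 i| := by fun_prop
    filter_upwards [(hc.tendsto p₀).eventually_lt_const (lt_add_one _)]
      with p hp
    -- The bound uses `|b h|` because `b` need not be nonnegative when `ι` is empty.
    refine Eventually.of_forall fun h => abs_sSup_image_le ((hG.ite hG' hT p.1).nonempty h)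
      fun x _ => (abs_pairing_le hb p.2 h x).trans ?_
    exact (mul_le_mul_of_nonneg_left (le_abs_self _)
      (Finset.sum_nonneg fun i _ => abs_nonneg _)).trans
      (mul_le_mul_of_nonneg_right hp.le (abs_nonneg _))
  -- Away from the null set where `T` equals the level, the cut-off value at a given state does not
  -- change under small changes of level.
  · have hne : ∀ᵐ h ∂μ, T h ≠ p₀.1 := by
      rw [ae_iff]; simpa using hT0 p₀.1
    filter_upwards [hne] with h hh
    have hcont : ∀ K : Set X, IsCompact K →
        Continuous fun p : ℝ × (ι → ℝ) => sSup (pairing p.2 r h '' K) := fun K hK =>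
      hK.continuous_sSup <| continuous_finsetSum _ fun i _ =>
        ((continuous_apply i).comp (continuous_snd.comp continuous_fst)).mul
          (((hr i).continuous h).comp continuous_snd)
    rcases lt_or_gt_of_ne hh with h1 | h1
    · refine (hcont (G h) (hG.isCompact h)).continuousAt.congr ?_
      filter_upwards [continuous_fst.continuousAt.eventually_const_lt h1] with p hp
      rw [if_pos hp.le]
    · refine (hcont (G' h) (hG'.isCompact h)).continuousAt.congr ?_
      filter_upwards [continuous_fst.continuousAt.eventually_lt_const h1] with p hp
      rw [if_neg (not_le.2 hp)]

/-- Passing to the maximizers of a functional `ℓ` that is tight at `x` keeps the support function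
inequalities at `x`. -/
theorem MeasurableCorrespondence.le_integral_sSup_maximizers {G : H → Set X}
    (hG : MeasurableCorrespondence G) (hr : ∀ i, Caratheodory fun h x => r h x i)
    (hb : ∀ h x i, |r h x i| ≤ b h) (hbi : Integrable b μ) {x ℓ ℓ' : ι → ℝ}
    (hℓ : ∫ h, sSup (pairing ℓ r h '' G h) ∂μ = ℓ ⬝ᵥ x)
    (hx : ∀ n : ℕ, (ℓ' + (n : ℝ) • ℓ) ⬝ᵥ x ≤
      ∫ h, sSup (pairing (ℓ' + (n : ℝ) • ℓ) r h '' G h) ∂μ) :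
    ℓ' ⬝ᵥ x ≤ ∫ h, sSup (pairing ℓ' r h '' _root_.maximizers (G h) (pairing ℓ r h)) ∂μ := by
  have hcar := caratheodory_pairing hr
  set m : H → ℝ := fun h => sSup (pairing ℓ r h '' G h) with hm
  -- The penalized supremum is the support function of `ℓ' + n • ℓ` minus `n * m`. After
  -- integration, tightness of `ℓ` cancels the terms in `n`, so `ℓ' ⬝ᵥ x` bounds every `∫ F n` from
  -- below.
  set F : ℕ → H → ℝ := fun n h =>
    sSup ((fun y => pairing ℓ' r h y + n * (pairing ℓ r h y - m h)) '' G h) with hF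
  have hFeq : ∀ n h, F n h = sSup (pairing (ℓ' + (n : ℝ) • ℓ) r h '' G h) - n * m h := by
    intro n h
    have hK := hG.isCompact h
    have hne := hG.nonempty h
    have h1 := (hcar ℓ').continuous h
    have h2 := (hcar ℓ).continuous h
    apply le_antisymm
    · refine sSup_image_le_of_forall hne fun y hy => ?_
      have := hK.le_sSup_image ((hcar (ℓ' + (n : ℝ) • ℓ)).continuous h) hy
      rw [pairing_add_smul] at this
      linarith
    · rw [sub_le_iff_le_add]
      refine sSup_image_le_of_forall hne fun y hy => ?_
      have := hK.le_sSup_image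
        (f := fun y => pairing ℓ' r h y + n * (pairing ℓ r h y - m h)) (by fun_prop) hy
      simp only [pairing_add_smul, hF]
      linarith
  have hmi : Integrable m μ := hG.integrable_sSup_pairing hr hb hbi ℓ
  have hFi : ∀ n, Integrable (F n) μ := fun n => by
    simp only [funext (hFeq n)]
    exact (hG.integrable_sSup_pairing hr hb hbi _).sub (hmi.const_mul _)
  have hlim : Tendsto (fun n => ∫ h, F n h ∂μ) atTop
      (𝓝 (∫ h, sSup (pairing ℓ' r h '' _root_.maximizers (G h) (pairing ℓ r h)) ∂μ)) := by
    refine tendsto_integral_of_dominated_convergence (fun h => (∑ i, |ℓ' i|) * b h)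
      (fun n => (hFi n).aestronglyMeasurable) (hbi.const_mul _)
      (fun n => Eventually.of_forall fun h => ?_) (Eventually.of_forall fun h =>
        tendsto_sSup_penalized (hG.isCompact h) (hG.nonempty h) ((hcar ℓ').continuous h)
          ((hcar ℓ).continuous h))
    have hK := hG.isCompact h
    have hne := hG.nonempty h
    have hmax := abs_sSup_image_le (hK.maximizers_nonempty hne ((hcar ℓ).continuous h))
      fun x _ => abs_pairing_le hb ℓ' h x
    refine abs_le.2 ⟨(abs_le.1 hmax).1.trans (sSup_maximizers_le_penalized hK hne
      ((hcar ℓ').continuous h) ((hcar ℓ).continuous h) n),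
      sSup_image_le_of_forall hne fun y hy => ?_⟩
    have h1 := (abs_le.1 (abs_pairing_le hb ℓ' h y)).2
    have h2 : pairing ℓ r h y ≤ m h := hK.le_sSup_image ((hcar ℓ).continuous h) hy
    have h3 : (n : ℝ) * (pairing ℓ r h y - m h) ≤ 0 :=
      mul_nonpos_of_nonneg_of_nonpos n.cast_nonneg (sub_nonpos.2 h2)
    linarith
  refine ge_of_tendsto' hlim fun n => ?_
  have h1 := hx n
  simp only [funext (hFeq n)]
  rw [integral_sub (hG.integrable_sSup_pairing hr hb hbi _) (hmi.const_mul _), integral_const_mul,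
    hℓ]
  rw [add_dotProduct, smul_dotProduct, smul_eq_mul] at h1
  linarith

/-- Restricting the functionals to a subspace `W` makes induction on dimension possible. Once the
selection lies in the face of a tight `ℓ`, its integral is already correct in the direction `ℓ`, and
only a complement of `ℓ` in `W` remains. -/
theorem MeasurableCorrespondence.exists_selection_integral_pairing {κ : Type*} [Fintype κ]
    {c : κ → X → ℝ} (hc : ∀ j, Continuous (c j)) (hinj : ∀ x y, (∀ j, c j x = c j y) → x = y)
    (hr : ∀ i, Caratheodory fun h x => r h x i) (hb : ∀ h x i, |r h x i| ≤ b h)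
    (hbi : Integrable b μ) (hT : Measurable T) (hT0 : ∀ s, μ {h | T h = s} = 0)
    (hTpos : ∀ h, 0 < T h) (hTle : ∀ h, T h ≤ 1) (W : Submodule ℝ (ι → ℝ)) {G : H → Set X}
    (hG : MeasurableCorrespondence G) {x : ι → ℝ}
    (hx : ∀ ℓ ∈ W, ℓ ⬝ᵥ x ≤ ∫ h, sSup (pairing ℓ r h '' G h) ∂μ) :
    ∃ u : H → X, (∀ h, u h ∈ G h) ∧ (MeasurableCorrespondence fun h => {u h}) ∧
      ∀ ℓ ∈ W, ∫ h, pairing ℓ r h (u h) ∂μ = ℓ ⬝ᵥ x := by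
  induction hn : Module.finrank ℝ W using Nat.strong_induction_on generalizing W G x with
  | _ n ih =>
  obtain ⟨u₀, hu₀G, hu₀⟩ := hG.exists_selection hc hinj
  rcases eq_or_ne W ⊥ with rfl | hW
  · refine ⟨u₀, hu₀G, hu₀, fun ℓ hℓ => ?_⟩
    rw [(Submodule.mem_bot ℝ).1 hℓ]
    simp [pairing]
  -- The level `s` interpolates between the single selection `u₀` at `0` and the full `G` at `1`,
  -- since `T` takes values in `(0, 1]`.
  set Gs : ℝ → H → Set X := fun s h => if T h ≤ s then G h else {u₀ h} with hGs
  have hGsm : ∀ s, MeasurableCorrespondence (Gs s) := fun s => hG.ite hu₀ hT s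
  set F : ℝ → (ι → ℝ) → ℝ := fun s ℓ => (∫ h, sSup (pairing ℓ r h '' Gs s h) ∂μ) - ℓ ⬝ᵥ x with hF
  have hFc : Continuous (Function.uncurry F) := by
    refine (hG.continuous_integral_sSup_ite hu₀ hr hb hbi hT hT0).sub ?_
    unfold dotProduct
    fun_prop
  set S₁ : Set (ι → ℝ) := (W : Set (ι → ℝ)) ∩ Metric.sphere 0 1 with hS
  have hSc : IsCompact S₁ := (isCompact_sphere _ _).inter_left W.closed_of_finiteDimensional
  have hnorm : ∀ ℓ ∈ W, ℓ ≠ 0 → ‖ℓ‖⁻¹ • ℓ ∈ S₁ := fun ℓ hℓ h0 =>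
    ⟨W.smul_mem _ hℓ, by simp [norm_smul, norm_ne_zero_iff.2 h0]⟩
  have hSne : S₁.Nonempty := by
    obtain ⟨ℓ, hℓ, h0⟩ := W.exists_mem_ne_zero_of_ne_bot hW
    exact ⟨_, hnorm ℓ hℓ h0⟩
  have hhom : ∀ s t : ℝ, 0 ≤ t → ∀ ℓ, F s (t • ℓ) = t * F s ℓ := by
    intro s t ht ℓ
    have : ∀ h, pairing (t • ℓ) r h = fun x => t * pairing ℓ r h x := fun h => by
      funext x; simp [pairing, Finset.mul_sum, mul_assoc]
    simp only [hF, this, sSup_image_const_mul _ ht, integral_const_mul, smul_dotProduct,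
      smul_eq_mul]
    ring
  have hext : ∀ s, (∀ ℓ ∈ S₁, 0 ≤ F s ℓ) → ∀ ℓ ∈ W, 0 ≤ F s ℓ := by
    intro s hs ℓ hℓ
    rcases eq_or_ne ℓ 0 with rfl | h0
    · simpa using (hhom s 0 le_rfl 0).ge
    · have h1 := hs _ (hnorm ℓ hℓ h0)
      rw [hhom _ _ (by positivity)] at h1
      exact nonneg_of_mul_nonneg_right h1 (by positivity)
  have hmin : Continuous fun s => sInf (F s '' S₁) := hSc.continuous_sInf hFc
  have hFs : ∀ s, Continuous (F s) := fun s => hFc.comp (Continuous.prodMk_right s)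
  have hmin_le : ∀ s, ∀ ℓ ∈ S₁, sInf (F s '' S₁) ≤ F s ℓ := fun s ℓ hℓ =>
    csInf_le (hSc.image (hFs s)).bddBelow (Set.mem_image_of_mem _ hℓ)
  -- If no inequality fails at level `0`, those for `ℓ` and `-ℓ` together say that `u₀` already has
  -- the required integrals.
  rcases le_or_gt 0 (sInf (F 0 '' S₁)) with h0 | h0
  · refine ⟨u₀, hu₀G, hu₀, fun ℓ hℓ => ?_⟩
    have hF0 : ∀ ℓ, F 0 ℓ = ∑ i, ℓ i * ∫ h, r h (u₀ h) i ∂μ - ℓ ⬝ᵥ x := fun ℓ => by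
      have : ∀ h, Gs 0 h = {u₀ h} := fun h => if_neg (not_le.2 (hTpos h))
      simp only [hF, this, Set.image_singleton, csSup_singleton]
      rw [hu₀.integral_pairing_comp hr hb hbi]
    have h1 := hext 0 (fun ℓ hℓ => h0.trans (hmin_le 0 ℓ hℓ)) ℓ hℓ
    have h2 := hext 0 (fun ℓ hℓ => h0.trans (hmin_le 0 ℓ hℓ)) (-ℓ) (W.neg_mem hℓ)
    rw [hF0] at h1 h2
    simp only [Pi.neg_apply, neg_mul, Finset.sum_neg_distrib, neg_dotProduct] at h2
    rw [hu₀.integral_pairing_comp hr hb hbi]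
    linarith
  have h1 : 0 ≤ sInf (F 1 '' S₁) := by
    refine le_csInf (hSne.image _) ?_
    rintro _ ⟨ℓ, hℓ, rfl⟩
    have : Gs 1 = G := funext fun h => if_pos (hTle h)
    simp only [hF, this]
    exact sub_nonneg.2 (hx ℓ hℓ.1)
  -- At the level where the minimum over the unit sphere of `W` is zero, all inequalities still hold
  -- and the minimizing `ℓ` is tight.
  obtain ⟨s, -, hs⟩ := intermediate_value_Icc zero_le_one hmin.continuousOn
    (Set.mem_Icc.2 ⟨h0.le, h1⟩)
  obtain ⟨ℓ, hℓ, hℓs⟩ := hSc.exists_sInf_image_eq hSne (hFs s).continuousOn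
  have hpos : ∀ ℓ' ∈ W, 0 ≤ F s ℓ' := hext s fun ℓ' hℓ' => hs.symm.le.trans (hmin_le s ℓ' hℓ')
  have htight : ∫ h, sSup (pairing ℓ r h '' Gs s h) ∂μ = ℓ ⬝ᵥ x :=
    sub_eq_zero.1 (hℓs.symm.trans hs)
  have hℓ0 : ℓ ≠ 0 := by
    rintro rfl
    simpa using hℓ.2
  obtain ⟨i, hi⟩ := Function.ne_iff.1 hℓ0
  -- As `ℓ i ≠ 0`, vanishing of the coordinate `i` cuts out a complement of the line through `ℓ` in
  -- `W`.
  set W' : Submodule ℝ (ι → ℝ) := W ⊓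
    LinearMap.ker (LinearMap.proj (R := ℝ) (φ := fun _ : ι => ℝ) i) with hW'
  have hlt : Module.finrank ℝ W' < n := by
    rw [← hn]
    refine Submodule.finrank_lt_finrank_of_lt (lt_of_le_of_ne inf_le_left fun heq => hi ?_)
    have : ℓ ∈ W' := heq ▸ hℓ.1
    exact this.2
  obtain ⟨u, huG, hu, hux⟩ := ih _ hlt W' ((hGsm s).maximizers (caratheodory_pairing hr ℓ))
    (x := x) (fun ℓ' hℓ' => (hGsm s).le_integral_sSup_maximizers hr hb hbi htight fun n =>
      sub_nonneg.1 (hpos _ (W.add_mem hℓ'.1 (W.smul_mem _ hℓ.1)))) rfl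
  have hul : ∫ h, pairing ℓ r h (u h) ∂μ = ℓ ⬝ᵥ x := by
    rw [← htight]
    exact integral_congr_ae (Eventually.of_forall fun h => (huG h).2)
  refine ⟨u, fun h => ?_, hu, fun v hv => ?_⟩
  · have := (huG h).1
    simp only [hGs] at this
    split_ifs at this
    · exact this
    · rw [Set.mem_singleton_iff.1 this]; exact hu₀G h
  -- This `t` splits `v` into a multiple of `ℓ`, handled by tightness, and an element of `W'`,
  -- handled by induction.
  · set t := v i / ℓ i with ht
    have hv' : v - t • ℓ ∈ W' := ⟨W.sub_mem hv (W.smul_mem _ hℓ.1), by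
      have : ℓ i ≠ 0 := hi
      simp [ht, this]⟩
    have h2 := hux _ hv'
    rw [hu.integral_pairing_comp hr hb hbi] at h2 hul ⊢
    simp only [Pi.sub_apply, Pi.smul_apply, smul_eq_mul, sub_mul, Finset.sum_sub_distrib, mul_assoc,
      ← Finset.mul_sum, hul, sub_dotProduct, smul_dotProduct] at h2
    linarith

/-- An Aumann-type theorem: under a measure that does not charge the level sets of some function,
every vector obeying the integrated support function inequalities is the integral of a measurable
selection. -/
theorem MeasurableCorrespondence.exists_selection_integral_eq {κ : Type*} [Fintype κ]
    {c : κ → X → ℝ} (hc : ∀ j, Continuous (c j)) (hinj : ∀ x y, (∀ j, c j x = c j y) → x = y)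
    (hr : ∀ i, Caratheodory fun h x => r h x i) (hb : ∀ h x i, |r h x i| ≤ b h)
    (hbi : Integrable b μ) (hT : Measurable T) (hT0 : ∀ s, μ {h | T h = s} = 0)
    (hTpos : ∀ h, 0 < T h) (hTle : ∀ h, T h ≤ 1) {G : H → Set X}
    (hG : MeasurableCorrespondence G) {x : ι → ℝ}
    (hx : ∀ ℓ, ℓ ⬝ᵥ x ≤ ∫ h, sSup (pairing ℓ r h '' G h) ∂μ) :
    ∃ u : H → X, (∀ h, u h ∈ G h) ∧ (MeasurableCorrespondence fun h => {u h}) ∧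
      ∀ i, ∫ h, r h (u h) i ∂μ = x i := by
  classical
  obtain ⟨u, huG, hu, h⟩ := hG.exists_selection_integral_pairing hc hinj hr hb hbi hT hT0 hTpos
    hTle ⊤ fun ℓ _ => hx ℓ
  refine ⟨u, huG, hu, fun i => ?_⟩
  have := h (Pi.single i 1) trivial
  rw [hu.integral_pairing_comp hr hb hbi] at this
  simpa [Pi.single_apply] using this

end SelectionIntegrals

/-! ### Lagrangian duality over compact convex sets -/

section Duality

/-- Lagrangian duality over a compact convex set, with linear objective and constraints: if no
multiplier pushes the dual function below `c`, then some feasible point attains at least `c`. -/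
theorem exists_feasible_of_forall_multiplier {ι : Type*} [Fintype ι] {A : Set (ι → ℝ)}
    (hA : IsCompact A) (hconv : Convex ℝ A) (w R : ι → ℝ) (c : ℝ)
    (hc : ∀ l : ι → ℝ, 0 ≤ l → ∃ a ∈ A, c ≤ w ⬝ᵥ a + l ⬝ᵥ (a - R)) :
    ∃ a ∈ A, R ≤ a ∧ c ≤ w ⬝ᵥ a := by
  classical
  by_contra! hcon
  -- Infeasibility at value `c` says that the graph of the objective over `A` misses an orthant; a
  -- strictly separating functional `(m, ν)` supplies the multiplier.
  let L : (ι → ℝ) →ₗ[ℝ] (ι → ℝ) × ℝ :=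
    LinearMap.prod LinearMap.id (∑ i, w i • LinearMap.proj (R := ℝ) (φ := fun _ : ι => ℝ) i)
  have hL : ∀ a, L a = (a, w ⬝ᵥ a) := fun a => by
    simp [L, dotProduct]
  have hdisj : Disjoint (L '' A) (Set.Ici R ×ˢ Set.Ici c) := by
    rw [Set.disjoint_left]
    rintro _ ⟨a, ha, rfl⟩ ⟨h1, h2⟩
    rw [hL] at h1 h2
    exact absurd h2 (not_le.2 (hcon a ha h1))
  obtain ⟨f, u, v, hfu, huv, hfv⟩ := geometric_hahn_banach_compact_closed
    (hconv.linear_image L) (hA.image L.continuous_of_finiteDimensional)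
    ((convex_Ici R).prod (convex_Ici c)) (isClosed_Ici.prod isClosed_Ici) hdisj
  set ν : ℝ := f (0, 1) with hν
  set m : ι → ℝ := fun i => f (Pi.single i 1, 0) with hm
  have hf : ∀ a t, f (a, t) = m ⬝ᵥ a + ν * t := by
    intro a t
    have : (a, t) = ∑ i, a i • ((Pi.single i 1, 0) : (ι → ℝ) × ℝ) + t • (0, 1) := by
      ext i
      · simp [Prod.fst_sum, Finset.sum_apply, Pi.single_apply]
      · simp [Prod.snd_sum]
    rw [this, map_add, map_sum]
    simp only [map_smul, smul_eq_mul, dotProduct, hm, hν, mul_comm]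
  have hbase : v < m ⬝ᵥ R + ν * c := by
    rw [← hf]; exact hfv _ ⟨Set.self_mem_Ici, Set.self_mem_Ici⟩
  -- A functional bounded below along a ray cannot decrease along it; applied to the rays of the
  -- orthant, this gives `ν ≥ 0` and `m ≥ 0`.
  have hray : ∀ d : ℝ, (∀ t : ℝ, 0 ≤ t → v < m ⬝ᵥ R + ν * c + t * d) → 0 ≤ d := by
    intro d hd
    by_contra! hneg
    have := hd ((m ⬝ᵥ R + ν * c - v) / (-d)) (div_nonneg (by linarith) (by linarith))
    rw [div_mul_eq_mul_div, div_neg, mul_div_assoc, div_self hneg.ne] at this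
    linarith
  have hν0 : 0 ≤ ν := hray ν fun t ht => by
    have := hfv (R, c + t) ⟨Set.self_mem_Ici, by simpa using ht⟩
    rw [hf] at this; linarith
  have hm0 : 0 ≤ m := fun i => hray (m i) fun t ht => by
    have := hfv (R + Pi.single i t, c) ⟨by simpa using ht, Set.self_mem_Ici⟩
    rw [hf, dotProduct_add, dotProduct_single] at this
    linarith
  have hsep : ∀ a ∈ A, m ⬝ᵥ a + ν * (w ⬝ᵥ a) < u := fun a ha => by
    rw [← hf, ← hL]; exact hfu _ ⟨a, ha, rfl⟩
  rcases hν0.eq_or_lt with h0 | hpos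
  · rw [← h0] at hsep hbase
    obtain ⟨B, hB⟩ := (hA.image (f := fun a => w ⬝ᵥ a) (by fun_prop)).bddAbove
    -- With `ν = 0` the constraints alone are violated by at least `v - u` in the direction `m`.
    -- This multiple of `m` pushes the Lagrangian down to `c - 1` or less on all of `A`.
    set t : ℝ := max 0 ((B - c + 1) / (v - u)) with ht
    have ht0 : 0 ≤ t := le_max_left _ _
    obtain ⟨a, ha, hca⟩ := hc (t • m) (smul_nonneg ht0 hm0)
    have h1 : w ⬝ᵥ a ≤ B := hB ⟨a, ha, rfl⟩
    have h2 := hsep a ha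
    have h3 : B - c + 1 ≤ t * (v - u) := by
      rw [← div_le_iff₀ (by linarith)]; exact le_max_right _ _
    rw [smul_dotProduct, smul_eq_mul, dotProduct_sub] at hca
    have h4 : t * (v - u) ≤ t * (m ⬝ᵥ R - m ⬝ᵥ a) :=
      mul_le_mul_of_nonneg_left (by linarith) ht0
    linarith
  · obtain ⟨a, ha, hca⟩ := hc (ν⁻¹ • m) (smul_nonneg (by positivity) hm0)
    have h2 := hsep a ha
    rw [smul_dotProduct, smul_eq_mul, dotProduct_sub] at hca
    have h3 := mul_le_mul_of_nonneg_left hca hpos.le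
    rw [mul_add, mul_inv_cancel_left₀ hpos.ne'] at h3
    linarith

end Duality

/-! ### Effective powers: compactness, continuity and bounds for the rates -/

namespace MCNOMA

namespace System

variable {K N : ℕ} {S : System K N}

theorem assignSet_mem_Icc {q : Fin K → Fin N → ℝ} (hq : q ∈ S.assignSet) (k : Fin K) (i : Fin N) :
    q k i ∈ Set.Icc (0 : ℝ) 1 := by
  rcases hq.1 k i with h | h <;> simp [h]

theorem le_Pmax_of_mem_powerSet {p : Fin K → Fin N → ℝ} (hp : p ∈ S.powerSet) (k : Fin K)
    (i : Fin N) : p k i ≤ S.Pmax :=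
  ((Finset.single_le_sum (f := fun k => p k i) (fun k _ => hp.2.2 k i) (Finset.mem_univ k)).trans
    (Finset.single_le_sum (f := fun i => ∑ k, p k i)
      (fun i _ => Finset.sum_nonneg fun k _ => hp.2.2 k i) (Finset.mem_univ i))).trans hp.1

theorem mem_powerSet_of_le {p p' : Fin K → Fin N → ℝ} (hp : p ∈ S.powerSet)
    (h0 : ∀ k i, 0 ≤ p' k i) (hle : ∀ k i, p' k i ≤ p k i) : p' ∈ S.powerSet :=
  ⟨(Finset.sum_le_sum fun i _ => Finset.sum_le_sum fun k _ => hle k i).trans hp.1,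
    fun k => (Finset.sum_le_sum fun i _ => hle k i).trans (hp.2.1 k), h0⟩

theorem isCompact_powerSet (S : System K N) : IsCompact S.powerSet := by
  have hcl : IsClosed S.powerSet := by
    simp only [powerSet, Set.ofPred_and, Set.ofPred_forall]
    exact (isClosed_le (by fun_prop) continuous_const).inter ((isClosed_iInter fun k =>
      isClosed_le (by fun_prop) continuous_const).inter (isClosed_iInter fun k =>
        isClosed_iInter fun i => isClosed_le continuous_const (by fun_prop)))
  refine IsCompact.of_isClosed_subset (isCompact_Icc (a := 0) (b := fun _ _ => S.Pmax)) hcl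
    fun p hp => ⟨fun k i => hp.2.2 k i, fun k i => le_Pmax_of_mem_powerSet hp k i⟩

theorem isCompact_assignSet (S : System K N) : IsCompact S.assignSet := by
  refine Set.Finite.isCompact ?_
  refine (Set.Finite.pi' fun _ : Fin K => Set.Finite.pi' fun _ : Fin N =>
    Set.toFinite ({0, 1} : Set ℝ)).subset fun q hq k i => ?_
  exact hq.1 k i

/-- Effective power allocations: powers after masking by the subchannel assignment. -/
def actionSet (S : System K N) : Set (Fin K → Fin N → ℝ) :=
  Set.image2 (fun p q => q * p) S.powerSet S.assignSet

theorem isCompact_actionSet (S : System K N) : IsCompact S.actionSet := by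
  rw [actionSet, ← Set.image_prod]
  exact (S.isCompact_powerSet.prod S.isCompact_assignSet).image (by fun_prop)

theorem mem_powerSet_of_mem_actionSet {x : Fin K → Fin N → ℝ} (hx : x ∈ S.actionSet) :
    x ∈ S.powerSet := by
  obtain ⟨p, hp, q, hq, rfl⟩ := hx
  exact mem_powerSet_of_le hp
    (fun k i => mul_nonneg (assignSet_mem_Icc hq k i).1 (hp.2.2 k i))
    fun k i => mul_le_of_le_one_left (hp.2.2 k i) (assignSet_mem_Icc hq k i).2

/-- The subchannel assignment read off from an effective power allocation. -/
noncomputable def support (x : Fin K → Fin N → ℝ) (k : Fin K) (i : Fin N) : ℝ :=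
  if x k i = 0 then 0 else 1

theorem support_mem_assignSet {x : Fin K → Fin N → ℝ} (hx : x ∈ S.actionSet) :
    support x ∈ S.assignSet := by
  obtain ⟨p, hp, q, hq, rfl⟩ := hx
  refine ⟨fun k i => by unfold support; split_ifs <;> simp,
    fun k => (Finset.sum_le_sum fun i _ => ?_).trans (hq.2 k)⟩
  rcases hq.1 k i with h | h
  · simp [support, h]
  · unfold support
    split_ifs <;> simp [h]

theorem measurable_support : Measurable (support : (Fin K → Fin N → ℝ) → Fin K → Fin N → ℝ) := by
  refine measurable_pi_lambda _ fun k => measurable_pi_lambda _ fun i => ?_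
  exact Measurable.ite (measurableSet_eq_fun (by fun_prop) measurable_const) measurable_const
    measurable_const

/-- Powers and assignments enter only through their product, so a policy may be replaced by its
effective powers; `rate_support` allows the way back. -/
theorem rate_eq_rate_one (p q : Fin K → Fin N → ℝ) (h : Channel K N) (i : Fin N) :
    S.rate p q h i = S.rate (q * p) 1 h i := by
  simp [rate, subRate]

theorem rate_support (x : Fin K → Fin N → ℝ) (h : Channel K N) (i : Fin N) :
    S.rate x (support x) h i = S.rate x 1 h i := by
  rw [rate_eq_rate_one]
  congr 1
  ext k i
  by_cases hx : x k i = 0 <;> simp [support, hx]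

theorem measurable_ncr (S : System K N) (k : Fin K) (i : Fin N) :
    Measurable fun h : Channel K N => S.ncr h k i := by
  unfold ncr
  fun_prop

theorem measurable_rate (S : System K N) {p q : Channel K N → Fin K → Fin N → ℝ}
    (hp : Measurable p) (hq : Measurable q) (i : Fin N) :
    Measurable fun h => S.rate (p h) (q h) h i := by
  have hqp : ∀ k j, Measurable fun h => q h k j * p h k j := fun k j => by fun_prop
  unfold rate subRate
  refine Finset.measurable_sum _ fun k _ => Measurable.const_mul ?_ _
  simp only [Real.logb, Finset.sum_filter]
  refine (Real.measurable_log.comp (measurable_const.add ((hqp k i).div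
    ((Finset.measurable_sum _ fun j _ => ?_).add (S.measurable_ncr k i))))).div_const _
  exact Measurable.ite (measurableSet_lt (S.measurable_ncr k j) (S.measurable_ncr k i)) (hqp k j)
    measurable_const

theorem ncr_nonneg (hnoise : ∀ k i, 0 < S.noise k i) (h : Channel K N) (k : Fin K) (i : Fin N) :
    0 ≤ S.ncr h k i :=
  div_nonneg (hnoise k i).le (sq_nonneg _)

theorem ncr_pos (hnoise : ∀ k i, 0 < S.noise k i) {h : Channel K N} {k : Fin K} {i : Fin N}
    (hh : h k i ≠ 0) : 0 < S.ncr h k i :=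
  div_pos (hnoise k i) (by positivity)

theorem ncr_of_eq_zero {h : Channel K N} {k : Fin K} {i : Fin N} (hh : h k i = 0) :
    S.ncr h k i = 0 := by
  simp [ncr, hh]

/-- At zero gain, division by zero makes the noise-to-channel ratio `0`. No user then interferes,
and the quotient in the rate is again a division by zero. Continuity in the powers thus holds at
every channel state, not just almost every one. -/
theorem subRate_of_eq_zero (hnoise : ∀ k i, 0 < S.noise k i) (p q : Fin K → Fin N → ℝ)
    {h : Channel K N} {k : Fin K} {i : Fin N} (hh : h k i = 0) : S.subRate p q h k i = 0 := by
  have : ∀ j, ¬ S.ncr h k j < 0 := fun j => not_lt.2 (ncr_nonneg hnoise h k j)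
  simp [subRate, ncr_of_eq_zero hh, this]

theorem continuous_actionSet_apply (k : Fin K) (i : Fin N) :
    Continuous fun x : S.actionSet => x.1 k i :=
  (continuous_apply_apply k i).comp continuous_subtype_val

theorem continuous_rate (hnoise : ∀ k i, 0 < S.noise k i) (h : Channel K N) (i : Fin N) :
    Continuous fun x : S.actionSet => S.rate x 1 h i := by
  refine continuous_finsetSum _ fun k _ => ?_
  by_cases hh : h k i = 0
  · simp only [subRate_of_eq_zero hnoise _ _ hh]
    exact continuous_const
  have hη := ncr_pos hnoise hh
  have h0 : ∀ (x : S.actionSet) j, 0 ≤ x.1 k j := fun x j =>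
    (mem_powerSet_of_mem_actionSet x.2).2.2 k j
  have hden : ∀ x : S.actionSet,
      0 < (∑ j with S.ncr h k j < S.ncr h k i, x.1 k j) + S.ncr h k i := fun x =>
    add_pos_of_nonneg_of_pos (Finset.sum_nonneg fun j _ => h0 x j) hη
  simp only [subRate, Pi.one_apply, one_mul]
  refine continuous_const.mul (Continuous.logb (continuous_const.add (Continuous.div
    (continuous_actionSet_apply k i)
    ((continuous_finsetSum _ fun j _ => continuous_actionSet_apply k j).add continuous_const) fun x => (hden x).ne')) fun x => ?_)
  have := div_nonneg (h0 x i) (hden x).le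
  positivity

/-- A bound on all data rates, uniform in the effective power allocation. -/
noncomputable def rateBound (S : System K N) (h : Channel K N) : ℝ :=
  ∑ k, ∑ i, |S.B k| / Real.log 2 *
    (Real.log (1 + S.Pmax / S.noise k i) + Real.log (1 + ‖h k i‖ ^ 2))

/-- Dropping the interference bounds the signal ratio by a constant times the squared gain, and `1 +
a * b ≤ (1 + a) * (1 + b)` for `a, b ≥ 0` separates the two inside the logarithm. -/
theorem abs_rate_le (hnoise : ∀ k i, 0 < S.noise k i) (h : Channel K N) {x : Fin K → Fin N → ℝ}
    (hx : x ∈ S.powerSet) (i : Fin N) : |S.rate x 1 h i| ≤ S.rateBound h := by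
  have hP : ∀ k : Fin K, ∀ j : Fin N, 0 ≤ S.Pmax / S.noise k j := fun k j =>
    div_nonneg ((hx.2.2 k j).trans (le_Pmax_of_mem_powerSet hx k j)) (hnoise k j).le
  have hnn : ∀ k j, 0 ≤ |S.B k| / Real.log 2 *
      (Real.log (1 + S.Pmax / S.noise k j) + Real.log (1 + ‖h k j‖ ^ 2)) := fun k j =>
    mul_nonneg (div_nonneg (abs_nonneg _) (Real.log_nonneg one_le_two))
      (add_nonneg (Real.log_nonneg (by linarith [hP k j]))
        (Real.log_nonneg (by linarith [sq_nonneg ‖h k j‖])))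
  refine (Finset.abs_sum_le_sum_abs _ _).trans (Finset.sum_le_sum fun k _ => ?_)
  refine le_trans ?_ (Finset.single_le_sum (fun j _ => hnn k j) (Finset.mem_univ i))
  by_cases hh : h k i = 0
  · rw [subRate_of_eq_zero hnoise _ _ hh, abs_zero]
    exact hnn k i
  have hη := ncr_pos hnoise hh
  have hI : 0 ≤ ∑ j with S.ncr h k j < S.ncr h k i, x k j :=
    Finset.sum_nonneg fun j _ => hx.2.2 k j
  set z := x k i / ((∑ j with S.ncr h k j < S.ncr h k i, x k j) + S.ncr h k i) with hz
  have hz0 : 0 ≤ z := div_nonneg (hx.2.2 k i) (by positivity)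
  have hzle : z ≤ S.Pmax / S.noise k i * ‖h k i‖ ^ 2 := by
    calc z ≤ S.Pmax / S.ncr h k i :=
          div_le_div₀ ((hx.2.2 k i).trans (le_Pmax_of_mem_powerSet hx k i))
            (le_Pmax_of_mem_powerSet hx k i) hη (by linarith)
      _ = S.Pmax / S.noise k i * ‖h k i‖ ^ 2 := by
          rw [ncr, div_div_eq_mul_div, mul_div_right_comm]
  have hsq := sq_nonneg ‖h k i‖
  have hlog : Real.log (1 + z) ≤
      Real.log (1 + S.Pmax / S.noise k i) + Real.log (1 + ‖h k i‖ ^ 2) := by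
    have := hP k i
    rw [← Real.log_mul (by positivity) (by positivity)]
    exact Real.log_le_log (by positivity) (by nlinarith)
  have hlog2 : 0 < Real.log 2 := Real.log_pos one_lt_two
  simp only [subRate, Pi.one_apply, one_mul, ← hz, abs_mul, Real.logb, abs_div, abs_of_pos hlog2,
    abs_of_nonneg (Real.log_nonneg (show 1 ≤ 1 + z by linarith))]
  rw [mul_div_assoc', mul_div_right_comm]
  exact mul_le_mul_of_nonneg_left hlog (by positivity)

theorem measurable_rateBound (S : System K N) : Measurable S.rateBound := by
  unfold rateBound
  fun_prop

/-! ### Achievable average rates and strong duality -/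

section Averages

variable {Ω : Type*} [MeasurableSpace Ω] {ℙ : Measure Ω} {h : Ω → Channel K N}

theorem integrable_rateBound [IsFiniteMeasure ℙ] (S : System K N) (hmeas : Measurable h)
    (hint : ∀ k i, Integrable (fun ω => Real.log (1 + ‖h ω k i‖ ^ 2)) ℙ) :
    Integrable S.rateBound (ℙ.map h) := by
  rw [integrable_map_measure S.measurable_rateBound.aestronglyMeasurable hmeas.aemeasurable]
  change Integrable (fun ω => S.rateBound (h ω)) ℙ
  unfold rateBound
  exact integrable_finsetSum _ fun k _ => integrable_finsetSum _ fun i _ =>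
    ((integrable_const (Real.log (1 + S.Pmax / S.noise k i))).add (hint k i)).const_mul _

namespace Policy

theorem mem_actionSet (π : S.Policy) (h : Channel K N) : π.q h * π.p h ∈ S.actionSet :=
  ⟨_, π.p_mem h, _, π.q_mem h, rfl⟩

theorem measurable_rate (π : S.Policy) (i : Fin N) :
    Measurable fun h => S.rate (π.p h) (π.q h) h i :=
  S.measurable_rate π.measurable_p π.measurable_q i

theorem abs_rate_le (hnoise : ∀ k i, 0 < S.noise k i) (π : S.Policy) (h : Channel K N)
    (i : Fin N) : |S.rate (π.p h) (π.q h) h i| ≤ S.rateBound h := by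
  rw [rate_eq_rate_one]
  exact System.abs_rate_le hnoise h (mem_powerSet_of_mem_actionSet (π.mem_actionSet h)) i

theorem integrable_rate (hnoise : ∀ k i, 0 < S.noise k i) {μ : Measure (Channel K N)}
    (hb : Integrable S.rateBound μ) (π : S.Policy) (i : Fin N) :
    Integrable (fun h => S.rate (π.p h) (π.q h) h i) μ :=
  hb.mono' (π.measurable_rate i).aestronglyMeasurable
    (Filter.Eventually.of_forall fun h => π.abs_rate_le hnoise h i)

theorem avgRate_eq (π : S.Policy) (hmeas : Measurable h) (i : Fin N) :
    S.avgRate ℙ h π i = ∫ g, S.rate (π.p g) (π.q g) g i ∂(ℙ.map h) :=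
  (integral_map hmeas.aemeasurable (π.measurable_rate i).aestronglyMeasurable).symm

theorem objective_eq (hnoise : ∀ k i, 0 < S.noise k i) (hmeas : Measurable h)
    (hb : Integrable S.rateBound (ℙ.map h)) (π : S.Policy) :
    S.objective ℙ h π = S.w ⬝ᵥ S.avgRate ℙ h π := by
  unfold objective avgRate dotProduct
  rw [integral_finsetSum]
  · simp only [integral_const_mul]
  · exact fun i _ => ((π.integrable_rate hnoise hb i).comp_measurable hmeas).const_mul _

end Policy

/-- The rate as an integrand in the channel state and the effective power allocation. -/
noncomputable def actionRate (S : System K N) (h : Channel K N) (x : S.actionSet) (i : Fin N) : ℝ :=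
  S.rate x 1 h i

theorem caratheodory_actionRate (hnoise : ∀ k i, 0 < S.noise k i) (i : Fin N) :
    Caratheodory fun h x => S.actionRate h x i where
  measurable _ := S.measurable_rate measurable_const measurable_const i
  continuous h := continuous_rate hnoise h i

/-- The policy that follows a measurable selection of effective power allocations. -/
noncomputable def policyOfSelection (S : System K N) (u : Channel K N → S.actionSet)
    (hu : Measurable fun h => (u h : Fin K → Fin N → ℝ)) : S.Policy where
  p h := u h
  q h := support (u h : Fin K → Fin N → ℝ)
  measurable_p := hu
  measurable_q := measurable_support.comp hu
  p_mem h := mem_powerSet_of_mem_actionSet (u h).2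
  q_mem h := support_mem_assignSet (u h).2

/-- The achievable average rate vectors. -/
def achievable (S : System K N) (ℙ : Measure Ω) (h : Ω → Channel K N) : Set (Fin N → ℝ) :=
  Set.range (S.avgRate ℙ h)

/-- One channel entry suffices: an injective measurable map from `ℂ` to the reals, squashed by the
sigmoid, has level sets that each fix this entry to at most one value, which has probability zero.
-/
theorem exists_level_function (ℙ : Measure Ω) (hmeas : Measurable h)
    (k : Fin K) (i : Fin N) (hcont : ∀ z : ℂ, ℙ {ω | h ω k i = z} = 0) :
    ∃ T : Channel K N → ℝ, Measurable T ∧ (∀ s, (ℙ.map h) {g | T g = s} = 0) ∧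
      (∀ g, 0 < T g) ∧ ∀ g, T g ≤ 1 := by
  set e : ℂ → ℝ := fun z => Real.sigmoid (embeddingReal ℂ z) with he
  have hem : Measurable e :=
    continuous_sigmoid.measurable.comp (measurableEmbedding_embeddingReal ℂ).measurable
  have hinj : Function.Injective e :=
    Real.sigmoid_injective.comp (measurableEmbedding_embeddingReal ℂ).injective
  have hT : Measurable fun g : Channel K N => e (g k i) := by fun_prop
  refine ⟨fun g => e (g k i), hT, fun s => ?_, fun g => Real.sigmoid_pos _,
    fun g => Real.sigmoid_le_one _⟩
  rw [Measure.map_apply hmeas (measurableSet_eq_fun hT measurable_const)]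
  by_cases hs : ∃ z, e z = s
  · obtain ⟨z, rfl⟩ := hs
    refine measure_mono_null (fun ω hω => ?_) (hcont z)
    exact hinj hω
  · push Not at hs
    simp [hs]

theorem nonempty_actionSet (π : S.Policy) : Nonempty S.actionSet :=
  ⟨⟨_, π.mem_actionSet 0⟩⟩

theorem dotProduct_avgRate_le (hnoise : ∀ k i, 0 < S.noise k i) (hmeas : Measurable h)
    (hb : Integrable S.rateBound (ℙ.map h)) (π : S.Policy) (ℓ : Fin N → ℝ) :
    ℓ ⬝ᵥ S.avgRate ℙ h π ≤
      ∫ g, sSup (pairing ℓ S.actionRate g '' Set.univ) ∂(ℙ.map h) := by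
  have := isCompact_iff_compactSpace.1 S.isCompact_actionSet
  have := nonempty_actionSet π
  have hcar := fun i => caratheodory_actionRate hnoise i
  have h1 : ℓ ⬝ᵥ S.avgRate ℙ h π =
      ∫ g, ∑ i, ℓ i * S.rate (π.p g) (π.q g) g i ∂(ℙ.map h) := by
    rw [integral_finsetSum _ fun i _ => (π.integrable_rate hnoise hb i).const_mul _]
    simp only [integral_const_mul, dotProduct, π.avgRate_eq hmeas]
  rw [h1]
  refine integral_mono
    (integrable_finsetSum _ fun i _ => (π.integrable_rate hnoise hb i).const_mul _)
    (MeasurableCorrespondence.univ.integrable_sSup_pairing hcar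
      (fun g x i => abs_rate_le hnoise g (mem_powerSet_of_mem_actionSet x.2) i) hb ℓ) fun g => ?_
  have := isCompact_univ.le_sSup_image ((caratheodory_pairing hcar ℓ).continuous g)
    (Set.mem_univ (⟨_, π.mem_actionSet g⟩ : S.actionSet))
  simpa only [pairing, actionRate, ← rate_eq_rate_one] using this

theorem rate_eq_zero_of_isEmpty (hKN : IsEmpty (Fin K) ∨ IsEmpty (Fin N))
    (p q : Fin K → Fin N → ℝ) (h : Channel K N) (i : Fin N) : S.rate p q h i = 0 := by
  rcases hKN with hK | hN
  · simp [rate]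
  · exact hN.elim i

/-- This is where nonconvexity disappears: the right-hand side is visibly closed and convex. The
policy `π` only guarantees that the action set is nonempty. -/
theorem achievable_eq (hnoise : ∀ k i, 0 < S.noise k i) (hmeas : Measurable h)
    (hcont : ∀ k i (z : ℂ), ℙ {ω | h ω k i = z} = 0)
    (hb : Integrable S.rateBound (ℙ.map h)) (π : S.Policy) :
    S.achievable ℙ h = {a | ∀ ℓ : Fin N → ℝ,
      ℓ ⬝ᵥ a ≤ ∫ g, sSup (pairing ℓ S.actionRate g '' Set.univ) ∂(ℙ.map h)} := by
  have := isCompact_iff_compactSpace.1 S.isCompact_actionSet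
  have := nonempty_actionSet π
  refine Set.Subset.antisymm ?_ fun a ha => ?_
  · rintro _ ⟨π, rfl⟩ ℓ
    exact dotProduct_avgRate_le hnoise hmeas hb π ℓ
  -- Without any channel entry there is no level function, but then all rates vanish and the
  -- half-spaces for plus and minus each unit vector force `a = 0`.
  by_cases hKN : IsEmpty (Fin K) ∨ IsEmpty (Fin N)
  · have h0 : ∀ ℓ g, pairing ℓ S.actionRate g = fun _ => 0 := fun ℓ g => by
      funext x
      simp [pairing, actionRate, rate_eq_zero_of_isEmpty hKN]
    have h1 : ∀ ℓ : Fin N → ℝ, ℓ ⬝ᵥ a ≤ 0 := fun ℓ => by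
      simpa [h0, Set.image_univ] using ha ℓ
    refine ⟨π, funext fun i => ?_⟩
    have h2 := h1 (Pi.single i 1)
    have h3 := h1 (-Pi.single i 1)
    simp only [neg_dotProduct, single_dotProduct] at h2 h3
    simp only [avgRate, rate_eq_zero_of_isEmpty hKN, integral_zero]
    linarith
  · rw [not_or, not_isEmpty_iff, not_isEmpty_iff] at hKN
    obtain ⟨⟨k₀⟩, ⟨i₀⟩⟩ := hKN
    obtain ⟨T, hT, hT0, hTpos, hTle⟩ := exists_level_function ℙ hmeas k₀ i₀ (hcont k₀ i₀)
    obtain ⟨u, -, hu, hua⟩ := MeasurableCorrespondence.univ.exists_selection_integral_eq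
      (c := fun (j : Fin K × Fin N) (x : S.actionSet) => x.1 j.1 j.2) (fun j => continuous_actionSet_apply j.1 j.2)
      (fun x y hxy => Subtype.ext (funext fun k => funext fun i => hxy (k, i)))
      (caratheodory_actionRate hnoise)
      (fun g x i => abs_rate_le hnoise g (mem_powerSet_of_mem_actionSet x.2) i) hb hT hT0 hTpos hTle
      ha
    have hum : Measurable fun g => (u g : Fin K → Fin N → ℝ) :=
      measurable_pi_lambda _ fun k => measurable_pi_lambda _ fun i =>
        hu.measurable_comp (g := fun _ x => x.1 k i)
          ⟨fun _ => measurable_const, fun _ => continuous_actionSet_apply k i⟩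
    refine ⟨S.policyOfSelection u hum, funext fun i => ?_⟩
    rw [Policy.avgRate_eq _ hmeas, ← hua i]
    simp only [policyOfSelection, rate_support, actionRate]

theorem isCompact_achievable (hnoise : ∀ k i, 0 < S.noise k i) (hmeas : Measurable h)
    (hcont : ∀ k i (z : ℂ), ℙ {ω | h ω k i = z} = 0)
    (hb : Integrable S.rateBound (ℙ.map h)) (π : S.Policy) : IsCompact (S.achievable ℙ h) := by
  set c : ℝ := ∫ g, S.rateBound g ∂(ℙ.map h) with hc
  refine IsCompact.of_isClosed_subset
    (isCompact_Icc (a := fun _ : Fin N => -c) (b := fun _ => c)) ?_ ?_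
  · rw [achievable_eq hnoise hmeas hcont hb π, Set.ofPred_forall]
    refine isClosed_iInter fun ℓ => isClosed_le ?_ continuous_const
    unfold dotProduct
    fun_prop
  · rintro _ ⟨π, rfl⟩
    have : ∀ i, |S.avgRate ℙ h π i| ≤ c := fun i => by
      rw [π.avgRate_eq hmeas]
      rw [← Real.norm_eq_abs]
      exact norm_integral_le_of_norm_le hb
        (Filter.Eventually.of_forall fun g => π.abs_rate_le hnoise g i)
    exact ⟨fun i => (abs_le.1 (this i)).1, fun i => (abs_le.1 (this i)).2⟩

theorem convex_achievable (hnoise : ∀ k i, 0 < S.noise k i) (hmeas : Measurable h)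
    (hcont : ∀ k i (z : ℂ), ℙ {ω | h ω k i = z} = 0)
    (hb : Integrable S.rateBound (ℙ.map h)) (π : S.Policy) : Convex ℝ (S.achievable ℙ h) := by
  rw [achievable_eq hnoise hmeas hcont hb π, Set.ofPred_forall]
  exact convex_iInter fun ℓ => convex_halfSpace_le
    ⟨fun x y => dotProduct_add ℓ x y, fun c x => dotProduct_smul c ℓ x⟩ _

theorem lagrangian_eq (hnoise : ∀ k i, 0 < S.noise k i) (hmeas : Measurable h)
    (hb : Integrable S.rateBound (ℙ.map h)) (π : S.Policy) (l : Fin N → ℝ) :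
    S.lagrangian ℙ h π l = S.w ⬝ᵥ S.avgRate ℙ h π + l ⬝ᵥ (S.avgRate ℙ h π - S.Rmin) := by
  rw [lagrangian, π.objective_eq hnoise hmeas hb]
  rfl

theorem primalValue_le_dualValue : S.primalValue ℙ h ≤ S.dualValue ℙ h := by
  refine iSup₂_le fun π hπ => le_iInf₂ fun l hl => ?_
  refine le_trans ?_ (le_iSup (fun π : S.Policy => (S.lagrangian ℙ h π l : EReal)) π)
  rw [EReal.coe_le_coe_iff, lagrangian]
  exact le_add_of_nonneg_right
    (Finset.sum_nonneg fun i _ => mul_nonneg (hl i) (sub_nonneg.2 (hπ i)))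

theorem dualValue_le_primalValue (hnoise : ∀ k i, 0 < S.noise k i) (hmeas : Measurable h)
    (hcont : ∀ k i (z : ℂ), ℙ {ω | h ω k i = z} = 0)
    (hb : Integrable S.rateBound (ℙ.map h)) : S.dualValue ℙ h ≤ S.primalValue ℙ h := by
  refine EReal.ge_of_forall_gt_iff_ge.1 fun c hc => ?_
  have hdual : ∀ l : Fin N → ℝ, 0 ≤ l → ∃ π : S.Policy, c < S.lagrangian ℙ h π l := by
    intro l hl
    obtain ⟨π, hπ⟩ := lt_iSup_iff.1 (lt_of_lt_of_le hc (iInf₂_le l hl))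
    exact ⟨π, EReal.coe_lt_coe_iff.1 hπ⟩
  -- A real number below the dual value rules out an empty set of policies, for which the dual
  -- function would be `⊥`.
  obtain ⟨π₀, -⟩ := hdual 0 le_rfl
  obtain ⟨_, ⟨π, rfl⟩, hfeas, hval⟩ := exists_feasible_of_forall_multiplier
    (isCompact_achievable hnoise hmeas hcont hb π₀) (convex_achievable hnoise hmeas hcont hb π₀)
    S.w S.Rmin c fun l hl => by
      obtain ⟨π, hπ⟩ := hdual l hl
      exact ⟨_, ⟨π, rfl⟩, (lagrangian_eq hnoise hmeas hb π l).symm ▸ hπ.le⟩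
  rw [← π.objective_eq hnoise hmeas hb] at hval
  exact (EReal.coe_le_coe_iff.2 hval).trans
    (le_iSup₂ (f := fun (π : S.Policy) (_ : ∀ i, S.Rmin i ≤ S.avgRate ℙ h π i) =>
      (S.objective ℙ h π : EReal)) π hfeas)

end Averages

end System

end MCNOMA

theorem theorem6 {K N : ℕ} (S : MCNOMA.System K N)
    (hnoise : ∀ k i, 0 < S.noise k i)
    {Ω : Type*} [MeasurableSpace Ω] (ℙ : Measure Ω) [IsProbabilityMeasure ℙ]
    (h : Ω → MCNOMA.Channel K N) (hmeas : Measurable h)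
    (hcont : ∀ k i (z : ℂ), ℙ {ω | h ω k i = z} = 0)
    (hint : ∀ k i, Integrable (fun ω => Real.log (1 + ‖h ω k i‖ ^ 2)) ℙ) :
    S.primalValue ℙ h = S.dualValue ℙ h := by
  have hb := S.integrable_rateBound hmeas hint
  exact le_antisymm MCNOMA.System.primalValue_le_dualValue
    (MCNOMA.System.dualValue_le_primalValue hnoise hmeas hcont hb)
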